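/- Let $k$ be an algebraically closed field, let $n, r \ge 1$ be integers, $G = GL_n(k)$, and let $C_r(\mathfrak{gl}_n)$ be the variety of all $r$-tuples of pairwise commuting $n \times n$ matrices over $k$. Let $P$ be the block lower triangular parabolic subgroup of $G$ corresponding to the partition $[m,m]$ if $n = 2m$, and $[m+1,m]$ if $n = 2m+1$, and let $\mathfrak{u}_P$ be the Lie algebra of its unipotent radical, i.e. the space of all matrices $\begin{pmatrix} 0 & 0 \\ A & 0 \end{pmatrix}$ with $A$ an arbitrary $m \times (n-m)$ matrix. Then $$\dim C_r(\mathfrak{gl}_n) \ \ge\ (r+1)\dim \mathfrak{u}_P + r .$$ More precisely, let $V = G\cdot(\mathfrak{u}_P + kI_n)^r$ be the set of all $r$-tuples $(g b_1 g^{-1}, \dots, g b_r g^{-1})$ with $g \in G$ and $b_1,\dots,b_r \in \mathfrak{u}_P + kI_n$. Then $V \subseteq C_r(\mathfrak{gl}_n)$ and $\dim V = (r+1)\dim\mathfrak{u}_P + r$. (The dimension of a subset of affine space is that of its Zariski closure, i.e. the Krull dimension of the coordinate ring of the closure.) Moreover, if $n \ge 4$ and $r \ge 9$, or $n \ge 12$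 and $r \ge 4$, then $$(r+1)\dim \mathfrak{u}_P + r \ >\ n^2 + (r-1)n ,$$ so that this bound is greater than the classical lower bound $n^2 + (r-1)n$. -/

import Mathlib

namespace CommutingVariety

/-- The commuting variety `C_r(gl_n)`: all `r`-tuples of pairwise commuting `n × n` matrices. -/
def commutingVariety (k : Type*) [Field k] (n r : ℕ) : Set (Fin r → Matrix (Fin n) (Fin n) k) :=
  {x | ∀ i j, x i * x j = x j * x i}

/-- The Lie algebra `u_P` of the unipotent radical of the parabolic subgroup `P` of `GL_n` of
block lower triangular matrices for the partition `[m, m]` (if `n = 2m`), `[m + 1, m]`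
(if `n = 2m + 1`): matrices `(0 0; A 0)` with `A` of size `⌊n/2⌋ × (n - ⌊n/2⌋)`. -/
def uP (k : Type*) [Field k] (n : ℕ) : Submodule k (Matrix (Fin n) (Fin n) k) where
  carrier := {X | ∀ i j : Fin n, ¬ (n - n / 2 ≤ (i : ℕ) ∧ (j : ℕ) < n - n / 2) → X i j = 0}
  add_mem' := by
    intro X Y hX hY i j h
    rw [Matrix.add_apply, hX i j h, hY i j h, add_zero]
  zero_mem' := by
    intro i j _
    rfl
  smul_mem' := by
    intro c X hX i j h
    rw [Matrix.smul_apply, hX i j h, smul_zero]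

/-- The subspace `b_P = u_P + k I_n` of `gl_n`. -/
def bP (k : Type*) [Field k] (n : ℕ) : Submodule k (Matrix (Fin n) (Fin n) k) :=
  uP k n ⊔ Submodule.span k {1}

/-- `G · (u_P + k I_n)^r`, the saturation of `b_P ^ r` under simultaneous conjugation by
`G = GL_n(k)`. -/
def saturation (k : Type*) [Field k] (n r : ℕ) : Set (Fin r → Matrix (Fin n) (Fin n) k) :=
  {x | ∃ (g : GL (Fin n) k) (b : Fin r → Matrix (Fin n) (Fin n) k),
    (∀ i, b i ∈ bP k n) ∧
      ∀ i, x i = (g : Matrix (Fin n) (Fin n) k) * b i * ((g⁻¹ : GL (Fin n) k) : Matrix _ _ k)}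

/-- The point of affine space of dimension `r n ^ 2` formed by the entries of an `r`-tuple of
matrices. -/
def coords {k : Type*} {n r : ℕ} (x : Fin r → Matrix (Fin n) (Fin n) k) :
    Fin r × Fin n × Fin n → k :=
  fun p => x p.1 p.2.1 p.2.2

/-- The dimension of a subset `V` of the affine space `gl_n ^ r`: the Krull dimension of the ring
`k[X] / I(V)`, the coordinate ring of the Zariski closure of `V`. -/
noncomputable def varietyDim {k : Type*} [Field k] {n r : ℕ}
    (V : Set (Fin r → Matrix (Fin n) (Fin n) k)) : WithBot ℕ∞ :=
  ringKrullDim (MvPolynomial (Fin r × Fin n × Fin n) k ⧸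
    MvPolynomial.vanishingIdeal k (coords '' V))

end CommutingVariety

/-! Conjugating tuples `c_i + (0 0; A_i 0)` by the opposite unipotent matrices `(1 B; 0 1)` already
gives a dense subset of the saturation: if the lower right block of `g` is invertible, then `g` is
such a matrix times an element of `P`, and `P` preserves `u_P + k I` (`conj_lowerMatrix_of_isUnit`).
Hence the vanishing ideal is the kernel of the comorphism `paramHom` (`vanishingIdeal_saturation`).
The parameters `B`, `A_i`, `c_i` number `(r + 1) dim u_P + r`. All are algebraic over the image of
`paramHom` (`isAlgebraic_X_of_paramTuple_mem`), so no dimension is lost. Commutativity holds because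
`u_P` has zero products, and the lower bound follows by monotonicity of dimension. -/

/-! ### Krull dimension of subalgebras of polynomial rings. -/

/-- Incomparability gives `≤`; lying over and going up lift chains of primes and give `≥`. -/
theorem ringKrullDim_eq_of_isIntegral (R S : Type*) [CommRing R] [CommRing S] [Algebra R S]
    [FaithfulSMul R S] [Algebra.IsIntegral R S] : ringKrullDim S = ringKrullDim R := by
  apply le_antisymm
  · refine Order.krullDim_le_of_strictMono (PrimeSpectrum.comap (algebraMap R S)) ?_
    intro I J h
    exact Ideal.IsIntegral.comap_lt_comap h
  · refine iSup_le fun p => ?_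
    have := p.head.2
    obtain ⟨Q, hQ, hQ'⟩ := (inferInstance : Nonempty (Ideal.primesOver p.head.asIdeal S))
    have := hQ'
    obtain ⟨L, hL, -⟩ := Ideal.exists_ltSeries_of_hasGoingUp p Q
    exact hL ▸ Order.LTSeries.length_le_krullDim L

/-- Noether normalization reduces the dimension to a number of variables, which additivity of
transcendence degree identifies with that of `τ`. -/
theorem MvPolynomial.ringKrullDim_range_of_isAlgebraic {k : Type*} [Field k] {σ τ : Type*}
    [Finite σ] [Finite τ] (φ : MvPolynomial σ k →ₐ[k] MvPolynomial τ k)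
    (h : ∀ x, IsAlgebraic φ.range (X x : MvPolynomial τ k)) :
    ringKrullDim φ.range = Nat.card τ := by
  have halg : Algebra.IsAlgebraic φ.range (MvPolynomial τ k) := by
    constructor
    intro x
    have : (MvPolynomial.aeval (R := k) (X : τ → MvPolynomial τ k)) x ∈
        (Subalgebra.algebraicClosure φ.range (MvPolynomial τ k)).restrictScalars k := by
      induction x using MvPolynomial.induction_on with
      | C a => rw [MvPolynomial.aeval_C]; exact Subalgebra.algebraMap_mem _ a
      | add p q hp hq => rw [map_add]; exact add_mem hp hq
      | mul_X p x hp => rw [map_mul, aeval_X]; exact mul_mem hp (h x)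
    rwa [aeval_X_left_apply] at this
  have : Algebra.FiniteType k φ.range :=
    Algebra.FiniteType.of_surjective φ.rangeRestrict φ.rangeRestrict_surjective
  obtain ⟨s, g, hg, hint⟩ := exists_integral_inj_algHom_of_fg k φ.range
  algebraize [g.toRingHom]
  have : FaithfulSMul (MvPolynomial (Fin s) k) φ.range :=
    (faithfulSMul_iff_algebraMap_injective _ _).2 hg
  have : Algebra.IsIntegral (MvPolynomial (Fin s) k) φ.range := ⟨hint⟩
  rw [ringKrullDim_eq_of_isIntegral (MvPolynomial (Fin s) k) φ.range,
    MvPolynomial.ringKrullDim_of_isNoetherianRing, ringKrullDim_eq_zero_of_field, zero_add]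
  have : IsScalarTower k (MvPolynomial (Fin s) k) φ.range :=
    .of_algebraMap_eq' g.comp_algebraMap.symm
  have h1 := lift_trdeg_add_eq k (MvPolynomial (Fin s) k) φ.range
  have h2 := lift_trdeg_add_eq k φ.range (MvPolynomial τ k)
  simp only [trdeg_eq_zero, MvPolynomial.trdeg_of_isDomain, Cardinal.lift_zero, add_zero,
    Cardinal.lift_lift] at h1 h2
  apply_fun Cardinal.toNat at h1 h2
  simp only [Cardinal.toNat_lift, Nat.card] at h1 h2 ⊢
  rw [h1, h2]

/-! ### Block matrices, the big cell and paths in `GL_n`. -/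

namespace CommutingVariety

open Matrix

variable {a b : Type*} [Fintype a] [Fintype b] [DecidableEq a] [DecidableEq b]

/-- The matrix `c • 1 + (0 0; A 0)`. -/
def lowerMatrix {R : Type*} [CommRing R] (A : Matrix b a R) (c : R) : Matrix (a ⊕ b) (a ⊕ b) R :=
  fromBlocks (c • 1) 0 A (c • 1)

/-- The conjugate of `c • 1 + (0 0; A 0)` by the block matrix `(1 B; 0 1)`. -/
def conjMatrix {R : Type*} [CommRing R] (B : Matrix a b R) (A : Matrix b a R) (c : R) :
    Matrix (a ⊕ b) (a ⊕ b) R :=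
  fromBlocks (c • 1 + B * A) (-(B * A * B)) A (c • 1 - A * B)

theorem conjMatrix_eq {R : Type*} [CommRing R] (B : Matrix a b R) (A : Matrix b a R) (c : R) :
    conjMatrix B A c =
      fromBlocks 1 B 0 1 * lowerMatrix A c * fromBlocks 1 (-B) 0 1 := by
  simp only [conjMatrix, lowerMatrix, fromBlocks_multiply, fromBlocks_inj]
  refine ⟨by simp, ?_, by simp, ?_⟩
  · simp [Matrix.add_mul]
  · simp [sub_eq_neg_add]

theorem unipotent_mul_neg {R : Type*} [CommRing R] (B : Matrix a b R) :
    (fromBlocks 1 B 0 1 : Matrix (a ⊕ b) (a ⊕ b) R) * fromBlocks 1 (-B) 0 1 = 1 := by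
  simp [fromBlocks_multiply]

theorem unipotent_neg_mul {R : Type*} [CommRing R] (B : Matrix a b R) :
    (fromBlocks 1 (-B) 0 1 : Matrix (a ⊕ b) (a ⊕ b) R) * fromBlocks 1 B 0 1 = 1 := by
  simp [fromBlocks_multiply]

theorem conj_lowerMatrix_of_isUnit {R : Type*} [CommRing R] {G G' : Matrix (a ⊕ b) (a ⊕ b) R}
    (h : G * G' = 1) (hd : IsUnit G.toBlocks₂₂.det) :
    ∃ (B : Matrix a b R) (D : Matrix b a R → Matrix b a R), ∀ A c,
      G * lowerMatrix A c * G' = conjMatrix B (D A) c := by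
  obtain ⟨p, q, s, d, rfl⟩ : ∃ p q s d, G = fromBlocks p q s d :=
    ⟨_, _, _, _, (fromBlocks_toBlocks G).symm⟩
  rw [toBlocks_fromBlocks₂₂] at hd
  -- Chosen so that left multiplication by `(1 -B; 0 1)` clears the upper right block of `G`.
  set B := q * d⁻¹ with hB
  have hBd : B * d = q := by rw [hB, Matrix.mul_assoc, nonsing_inv_mul _ hd, Matrix.mul_one]
  set U : Matrix (a ⊕ b) (a ⊕ b) R := fromBlocks 1 B 0 1 with hU
  set U' : Matrix (a ⊕ b) (a ⊕ b) R := fromBlocks 1 (-B) 0 1 with hU'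
  have hUU' : U * U' = 1 := unipotent_mul_neg B
  obtain ⟨p', q', s', d', hP'⟩ : ∃ p q s d, G' * U = fromBlocks p q s d :=
    ⟨_, _, _, _, (fromBlocks_toBlocks (G' * U)).symm⟩
  have hP : U' * fromBlocks p q s d = fromBlocks (p - B * s) 0 s d := by
    rw [hU', fromBlocks_multiply, fromBlocks_inj]
    refine ⟨by simp [sub_eq_add_neg], by simp [hBd], by simp, by simp⟩
  have hPP : (U' * fromBlocks p q s d) * (G' * U) = 1 := by
    rw [Matrix.mul_assoc, ← Matrix.mul_assoc _ G', h, Matrix.one_mul]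
    exact unipotent_neg_mul B
  rw [hP, hP', fromBlocks_multiply, ← fromBlocks_one, fromBlocks_inj] at hPP
  obtain ⟨h11, h12, h21, h22⟩ := hPP
  simp only [Matrix.zero_mul, add_zero] at h11 h12
  have hq' : q' = 0 := by
    have h11' := mul_eq_one_comm.1 h11
    rw [← Matrix.one_mul q', ← h11', Matrix.mul_assoc, h12, Matrix.mul_zero]
  subst hq'
  refine ⟨B, fun A => d * A * p', fun A c => ?_⟩
  rw [conjMatrix_eq]
  have key : (U' * fromBlocks p q s d) * lowerMatrix A c * (G' * U) =
      lowerMatrix (d * A * p') c := by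
    rw [hP, hP', lowerMatrix, lowerMatrix, fromBlocks_multiply, fromBlocks_multiply,
      fromBlocks_inj]
    simp only [Matrix.mul_zero, zero_add] at h22
    refine ⟨by simp [h11], by simp, ?_, by simp [h22]⟩
    simp only [Matrix.mul_smul, Matrix.mul_one, Matrix.add_mul, Matrix.smul_mul, Matrix.mul_zero,
      zero_add]
    rw [add_right_comm, ← smul_add, h21, smul_zero, zero_add]
  rw [← key]
  simp only [← hU, ← hU', Matrix.mul_assoc]
  rw [hUU', Matrix.mul_one, ← Matrix.mul_assoc U, hUU', Matrix.one_mul]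

-- Scaling each transvection parameter by `X` joins `M` to an invertible diagonal matrix. All
-- diagonal blocks are invertible at the end `0`, which is what the density argument needs.
open Polynomial in
theorem exists_polynomial_path {k n : Type*} [Field k] [Fintype n] [DecidableEq n]
    (M : Matrix n n k) (hM : M.det ≠ 0) :
    ∃ G G' : Matrix n n k[X], G * G' = 1 ∧ G.map (eval 1) = M ∧
      ∃ D : n → k, (∀ i, D i ≠ 0) ∧ G.map (eval 0) = diagonal D := by
  refine diagonal_transvection_induction_of_det_ne_zero
    (fun M => ∃ G G' : Matrix n n k[X], G * G' = 1 ∧ G.map (eval 1) = M ∧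
      ∃ D : n → k, (∀ i, D i ≠ 0) ∧ G.map (eval 0) = diagonal D) M hM ?_ ?_ ?_
  · intro D hD
    rw [det_diagonal, Finset.prod_ne_zero_iff] at hD
    refine ⟨diagonal fun i => C (D i), diagonal fun i => C (D i)⁻¹, ?_, ?_, D,
      fun i => hD i (Finset.mem_univ i), ?_⟩
    · rw [diagonal_mul_diagonal, ← diagonal_one]
      congr 1
      ext1 i
      rw [← C_mul, mul_inv_cancel₀ (hD i (Finset.mem_univ i)), C_1]
    · simp [diagonal_map]
    · simp [diagonal_map]
  · rintro ⟨i, j, hij, c⟩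
    refine ⟨transvection i j (C c * X), transvection i j (-(C c * X)), ?_, ?_, 1, by simp, ?_⟩
    · rw [transvection_mul_transvection_same _ _ hij]; simp
    · simp only [transvection, TransvectionStruct.toMatrix]
      ext s t
      simp [one_apply, single_apply, apply_ite (eval (1 : k))]
    · simp only [transvection]
      ext s t
      simp [one_apply, single_apply, apply_ite (eval (0 : k)), diagonal_apply]
  · rintro A B - - ⟨G, G', h, h1, D, hD, h0⟩ ⟨K, K', l, l1, E, hE, l0⟩
    refine ⟨G * K, K' * G', ?_, ?_, D * E, fun i => mul_ne_zero (hD i) (hE i), ?_⟩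
    · rw [Matrix.mul_assoc, ← Matrix.mul_assoc K, l, Matrix.one_mul, h]
    · rw [← h1, ← l1]
      exact Matrix.map_mul (f := evalRingHom (1 : k))
    · rw [← coe_evalRingHom] at h0 l0 ⊢
      rw [Matrix.map_mul, h0, l0, diagonal_mul_diagonal]
      rfl

/-! ### Algebraicity of the parameters over the matrix entries. -/

theorem det_smul_one_sub_conjMatrix [Nonempty a] {R : Type*} [CommRing R] (B : Matrix a b R)
    (A : Matrix b a R) (c : R) : (c • 1 - conjMatrix B A c).det = 0 := by
  have : c • 1 - conjMatrix B A c = conjMatrix B (-A) 0 := by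
    rw [← fromBlocks_one, fromBlocks_smul, conjMatrix, conjMatrix, sub_eq_add_neg, fromBlocks_neg,
      fromBlocks_add, fromBlocks_inj]
    refine ⟨by simp, by simp, by simp, by simp⟩
  rw [this, conjMatrix_eq, det_mul, det_mul, lowerMatrix, det_fromBlocks_zero₁₂]
  simp

theorem isIntegral_of_det_smul_one_sub_eq_zero {S R n : Type*} [CommRing S] [CommRing R]
    [Algebra S R] [Fintype n] [DecidableEq n] (M : Matrix n n S) (c : R)
    (h : (c • 1 - M.map (algebraMap S R)).det = 0) : IsIntegral S c := by
  refine ⟨M.charpoly, M.charpoly_monic, ?_⟩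
  rw [← Polynomial.eval_map, ← charpoly_map, eval_charpoly, ← h, scalar_apply, smul_one_eq_diagonal]

/-- Cramer's rule: `det A • B = (B * A) * adjugate A`, and the elements algebraic over `S` form a
subalgebra. -/
theorem isAlgebraic_of_isAlgebraic_mul {m l : Type*} [Fintype l] [DecidableEq l]
    {S R : Type*} [CommRing S] [IsDomain S] [CommRing R] [IsDomain R]
    [Algebra S R] (B : Matrix m l R) (A : Matrix l l R) (hA : A.det ≠ 0)
    (hA' : ∀ i j, IsAlgebraic S (A i j)) (hB : ∀ i j, IsAlgebraic S ((B * A) i j))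
    (i : m) (j : l) :
    IsAlgebraic S (B i j) := by
  let T := Subalgebra.algebraicClosure S R
  obtain ⟨A₀, rfl⟩ : ∃ A₀ : Matrix l l T, A₀.map (algebraMap T R) = A :=
    ⟨of fun i j => ⟨A i j, hA' i j⟩, rfl⟩
  obtain ⟨C₀, hC⟩ : ∃ C₀ : Matrix m l T, C₀.map (algebraMap T R) = B * A₀.map (algebraMap T R) :=
    ⟨of fun i j => ⟨_, hB i j⟩, rfl⟩
  rw [← RingHom.mapMatrix_apply, ← RingHom.map_det] at hA
  refine IsAlgebraic.of_mul (mem_nonZeroDivisors_of_ne_zero hA) A₀.det.2 ?_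
  have : algebraMap T R A₀.det • B = (C₀ * A₀.adjugate).map (algebraMap T R) := by
    rw [Matrix.map_mul, hC, Matrix.mul_assoc, ← Matrix.map_mul, mul_adjugate,
      Matrix.map_smul' _ _ _ (map_mul _), Matrix.map_one _ (map_zero _) (map_one _),
      Matrix.mul_smul, Matrix.mul_one]
  have h := congrFun₂ this i j
  rw [Matrix.smul_apply, smul_eq_mul] at h
  rw [h]
  exact ((C₀ * A₀.adjugate) i j).2

/-- The index set for the entries of `B`, `A₁, …, A_r` and `c₁, …, c_r`. -/
abbrev ParamIndex (r : ℕ) (a b : Type*) : Type _ := (a × b) ⊕ (Fin r × ((b × a) ⊕ Unit))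

/-- The `r`-tuple of matrices `(1 B; 0 1) (c_i + (0 0; A_i 0)) (1 B; 0 1)⁻¹`. -/
def paramTuple {r : ℕ} {R : Type*} [CommRing R] (v : ParamIndex r a b → R) (i : Fin r) :
    Matrix (a ⊕ b) (a ⊕ b) R :=
  conjMatrix (of fun s t => v (.inl (s, t))) (of fun s t => v (.inr (i, .inl (s, t))))
    (v (.inr (i, .inr ())))

/-- The `A_i` are lower left blocks, and each `c_i` is an eigenvalue, hence integral. Then `B * A_i`
is known from the upper left block, and `B` is recovered from a square submatrix of a single generic
`A_i`; this uses `r > 0`. -/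
theorem isAlgebraic_X_of_paramTuple_mem [Nonempty a] (ι : b ↪ a) {r : ℕ} (hr : 0 < r) {k : Type*}
    [Field k] (S : Subalgebra k (MvPolynomial (ParamIndex r a b) k))
    (hS : ∀ i s t, paramTuple MvPolynomial.X i s t ∈ S) (x : ParamIndex r a b) :
    IsAlgebraic S (MvPolynomial.X x : MvPolynomial (ParamIndex r a b) k) := by
  have key : ∀ y ∈ S, IsAlgebraic S y := fun y hy => isAlgebraic_algebraMap (⟨y, hy⟩ : S)
  have hA : ∀ i s t, IsAlgebraic S
      (MvPolynomial.X (.inr (i, .inl (s, t))) : MvPolynomial (ParamIndex r a b) k) :=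
    fun i s t => key _ (hS i (.inr s) (.inl t))
  have hc : ∀ i, IsAlgebraic S
      (MvPolynomial.X (.inr (i, .inr ())) : MvPolynomial (ParamIndex r a b) k) := fun i =>
    (isIntegral_of_det_smul_one_sub_eq_zero (of fun s t => (⟨_, hS i s t⟩ : S)) _
      (det_smul_one_sub_conjMatrix _ _ _)).isAlgebraic
  rcases x with ⟨s, t⟩ | ⟨i, ⟨s, t⟩ | ⟨⟩⟩
  · let i : Fin r := ⟨0, hr⟩
    let A : Matrix b a (MvPolynomial (ParamIndex r a b) k) :=
      of fun s t => MvPolynomial.X (.inr (i, .inl (s, t)))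
    let B : Matrix a b (MvPolynomial (ParamIndex r a b) k) :=
      of fun s t => MvPolynomial.X (.inl (s, t))
    refine isAlgebraic_of_isAlgebraic_mul B (A.submatrix id ι) ?_ (fun _ _ => hA _ _ _)
      (fun s t => ?_) s t
    · intro h
      -- A specialization turning the square submatrix into the identity, so its generic determinant
      -- is nonzero.
      let v : ParamIndex r a b → k :=
        Sum.elim 0 fun y => Sum.elim (fun z => if ι z.1 = z.2 then 1 else 0) 0 y.2
      have h1 := congrArg (MvPolynomial.eval v) h
      rw [RingHom.map_det, map_zero] at h1
      have h2 : (MvPolynomial.eval v).mapMatrix (A.submatrix id ι) = 1 := by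
        ext s t
        simp [A, v, one_apply]
      rw [h2, det_one] at h1
      exact one_ne_zero h1
    · have h : paramTuple MvPolynomial.X i (.inl s) (.inl (ι t)) =
          (MvPolynomial.X (.inr (i, .inr ())) : MvPolynomial (ParamIndex r a b) k) *
            (1 : Matrix a a (MvPolynomial (ParamIndex r a b) k)) s (ι t) +
            (B * A.submatrix id ι) s t := rfl
      rw [eq_sub_of_add_eq' h.symm]
      refine (key _ (hS _ _ _)).sub ((hc i).mul ?_)
      rw [one_apply]
      split_ifs
      exacts [isAlgebraic_one, isAlgebraic_zero]
  · exact hA i s t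
  · exact hc i

/-! ### Passage between block indices and `Fin n`. -/

/-- The block decomposition of the indices for the partition `[n - ⌊n/2⌋, ⌊n/2⌋]`. -/
def blockEquiv (n : ℕ) : Fin (n - n / 2) ⊕ Fin (n / 2) ≃ Fin n :=
  finSumFinEquiv.trans (finCongr (by omega))

@[simp] theorem blockEquiv_inl {n : ℕ} (i : Fin (n - n / 2)) : (blockEquiv n (.inl i) : ℕ) = i := by
  simp [blockEquiv]

@[simp] theorem blockEquiv_inr {n : ℕ} (i : Fin (n / 2)) :
    (blockEquiv n (.inr i) : ℕ) = n - n / 2 + i := by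
  simp [blockEquiv]

/-- The space `u_P` is the space of lower left blocks. -/
def uPEquiv (k : Type*) [Field k] (n : ℕ) :
    uP k n ≃ₗ[k] Matrix (Fin (n / 2)) (Fin (n - n / 2)) k where
  toFun X := of fun i j =>
    (X : Matrix (Fin n) (Fin n) k) (blockEquiv n (.inr i)) (blockEquiv n (.inl j))
  map_add' _ _ := rfl
  map_smul' _ _ := rfl
  invFun A := ⟨reindex (blockEquiv n) (blockEquiv n) (fromBlocks 0 0 A 0), by
    intro i j h
    obtain ⟨i, rfl⟩ := (blockEquiv n).surjective i
    obtain ⟨j, rfl⟩ := (blockEquiv n).surjective j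
    rcases i with i | i <;> rcases j with j | j <;> simp at h ⊢⟩
  left_inv X := by
    ext i j
    obtain ⟨i, rfl⟩ := (blockEquiv n).surjective i
    obtain ⟨j, rfl⟩ := (blockEquiv n).surjective j
    rcases i with i | i <;> rcases j with j | j
    · simpa using (X.2 _ _ (by simp; omega)).symm
    · simpa using (X.2 _ _ (by simp)).symm
    · simp
    · simpa using (X.2 _ _ (by simp)).symm
  right_inv A := by
    ext i j
    simp

theorem finrank_uP (k : Type*) [Field k] (n : ℕ) :
    Module.finrank k (uP k n) = n / 2 * (n - n / 2) := by
  rw [(uPEquiv k n).finrank_eq, Module.finrank_matrix]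
  simp

theorem mem_bP_iff {k : Type*} [Field k] {n : ℕ} {X : Matrix (Fin n) (Fin n) k} :
    X ∈ bP k n ↔ ∃ (A : Matrix (Fin (n / 2)) (Fin (n - n / 2)) k) (c : k),
      X = reindexAlgEquiv k k (blockEquiv n) (lowerMatrix A c) := by
  have key : ∀ (A : Matrix (Fin (n / 2)) (Fin (n - n / 2)) k) (c : k),
      reindexAlgEquiv k k (blockEquiv n) (lowerMatrix A c) = ((uPEquiv k n).symm A).1 + c • 1 := by
    intro A c
    have : lowerMatrix A c = fromBlocks 0 0 A 0 + c • 1 := by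
      rw [← fromBlocks_one, fromBlocks_smul, fromBlocks_add, lowerMatrix]
      simp
    rw [this, map_add, map_smul, map_one]
    rfl
  rw [bP, Submodule.mem_sup]
  constructor
  · rintro ⟨y, hy, z, hz, rfl⟩
    obtain ⟨c, rfl⟩ := Submodule.mem_span_singleton.1 hz
    exact ⟨uPEquiv k n ⟨y, hy⟩, c, by rw [key, LinearEquiv.symm_apply_apply]⟩
  · rintro ⟨A, c, rfl⟩
    exact ⟨_, ((uPEquiv k n).symm A).2, _, Submodule.mem_span_singleton.2 ⟨c, rfl⟩, (key A c).symm⟩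

theorem mem_saturation_iff {k : Type*} [Field k] {n r : ℕ}
    {x : Fin r → Matrix (Fin n) (Fin n) k} :
    x ∈ saturation k n r ↔
      ∃ (G G' : Matrix (Fin (n - n / 2) ⊕ Fin (n / 2)) (Fin (n - n / 2) ⊕ Fin (n / 2)) k)
        (A : Fin r → Matrix (Fin (n / 2)) (Fin (n - n / 2)) k) (c : Fin r → k), G * G' = 1 ∧
        ∀ i, x i = reindexAlgEquiv k k (blockEquiv n) (G * lowerMatrix (A i) (c i) * G') := by
  constructor
  · rintro ⟨g, b, hb, hx⟩
    choose A c h using fun i => mem_bP_iff.1 (hb i)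
    refine ⟨(reindexAlgEquiv k k (blockEquiv n)).symm g,
      (reindexAlgEquiv k k (blockEquiv n)).symm (g⁻¹ : GL (Fin n) k), A, c, ?_, fun i => ?_⟩
    · rw [← map_mul, ← Units.val_mul, mul_inv_cancel, Units.val_one, map_one]
    · rw [hx, h, map_mul, map_mul, AlgEquiv.apply_symm_apply, AlgEquiv.apply_symm_apply]
  · rintro ⟨G, G', A, c, h, hx⟩
    refine ⟨⟨reindexAlgEquiv k k (blockEquiv n) G, reindexAlgEquiv k k (blockEquiv n) G', ?_, ?_⟩,
      fun i => reindexAlgEquiv k k (blockEquiv n) (lowerMatrix (A i) (c i)),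
      fun i => mem_bP_iff.2 ⟨_, _, rfl⟩, fun i => ?_⟩
    · rw [← map_mul, h, map_one]
    · rw [← map_mul, mul_eq_one_comm.1 h, map_one]
    · rw [hx, map_mul, map_mul]
      rfl

/-! ### Commutativity and the numerical comparison. -/

theorem lowerMatrix_commute {R : Type*} [CommRing R] (A A' : Matrix b a R) (c c' : R) :
    lowerMatrix A c * lowerMatrix A' c' = lowerMatrix A' c' * lowerMatrix A c := by
  simp only [lowerMatrix, fromBlocks_multiply, fromBlocks_inj]
  refine ⟨?_, by simp, ?_, ?_⟩
  · simp [smul_smul, mul_comm]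
  · simp [add_comm]
  · simp [smul_smul, mul_comm]

theorem saturation_subset_commutingVariety (k : Type*) [Field k] (n r : ℕ) :
    saturation k n r ⊆ commutingVariety k n r := by
  intro x hx i j
  obtain ⟨G, G', A, c, h, hx⟩ := mem_saturation_iff.1 hx
  have key : ∀ i j, G * lowerMatrix (A i) (c i) * G' * (G * lowerMatrix (A j) (c j) * G') =
      G * (lowerMatrix (A i) (c i) * lowerMatrix (A j) (c j)) * G' := fun i j => by
    simp only [Matrix.mul_assoc]
    rw [← Matrix.mul_assoc G' G, mul_eq_one_comm.1 h, Matrix.one_mul]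
  rw [hx, hx, ← map_mul, ← map_mul, key, key, lowerMatrix_commute]

theorem lt_finrank_mul_add {n r d : ℕ} (hd : d = n / 2 * (n - n / 2))
    (h : (4 ≤ n ∧ 9 ≤ r) ∨ (12 ≤ n ∧ 4 ≤ r)) :
    n ^ 2 + (r - 1) * n < (r + 1) * d + r := by
  obtain ⟨r, rfl⟩ : ∃ s, r = s + 1 := ⟨r - 1, by omega⟩
  subst hd
  obtain ⟨m, rfl | rfl⟩ := n.even_or_odd'
  · have h1 : 2 * m / 2 = m := by omega
    have h2 : 2 * m - m = m := by omega
    rw [h1, h2, Nat.add_sub_cancel]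
    rcases h with ⟨h3, h4⟩ | ⟨h3, h4⟩
    -- After shifting `m` and `r` by their minimal values, the difference of the two sides is a
    -- polynomial with nonnegative coefficients; likewise in the other cases.
    · obtain ⟨m, rfl⟩ : ∃ s, m = s + 2 := ⟨m - 2, by omega⟩
      obtain ⟨r, rfl⟩ : ∃ s, r = s + 8 := ⟨r - 8, by omega⟩
      nlinarith [Nat.zero_le (r * m), Nat.zero_le (r * m * m)]
    · obtain ⟨m, rfl⟩ : ∃ s, m = s + 6 := ⟨m - 6, by omega⟩
      obtain ⟨r, rfl⟩ : ∃ s, r = s + 3 := ⟨r - 3, by omega⟩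
      nlinarith [Nat.zero_le (r * m), Nat.zero_le (r * m * m)]
  · have h1 : (2 * m + 1) / 2 = m := by omega
    have h2 : 2 * m + 1 - m = m + 1 := by omega
    rw [h1, h2, Nat.add_sub_cancel]
    rcases h with ⟨h3, h4⟩ | ⟨h3, h4⟩
    · obtain ⟨m, rfl⟩ : ∃ s, m = s + 2 := ⟨m - 2, by omega⟩
      obtain ⟨r, rfl⟩ : ∃ s, r = s + 8 := ⟨r - 8, by omega⟩
      nlinarith [Nat.zero_le (r * m), Nat.zero_le (r * m * m)]
    · obtain ⟨m, rfl⟩ : ∃ s, m = s + 6 := ⟨m - 6, by omega⟩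
      obtain ⟨r, rfl⟩ : ∃ s, r = s + 3 := ⟨r - 3, by omega⟩
      nlinarith [Nat.zero_le (r * m), Nat.zero_le (r * m * m)]

/-! ### Density of the parametrized tuples and the dimension. -/

theorem aeval_coords_map {k R R' : Type*} [CommRing k] [CommRing R] [CommRing R'] [Algebra k R]
    [Algebra k R'] {n r : ℕ} (ψ : R →ₐ[k] R') (x : Fin r → Matrix (Fin n) (Fin n) R)
    (f : MvPolynomial (Fin r × Fin n × Fin n) k) :
    ψ (MvPolynomial.aeval (coords x) f) = MvPolynomial.aeval (coords fun i => (x i).map ψ) f := by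
  rw [MvPolynomial.comp_aeval_apply]
  rfl

theorem lowerMatrix_map {m l R R' : Type*} [DecidableEq m] [DecidableEq l] [CommRing R]
    [CommRing R'] (ψ : R →+* R') (A : Matrix l m R) (c : R) :
    (lowerMatrix A c).map ψ = lowerMatrix (A.map ψ) (ψ c) := by
  simp [lowerMatrix, fromBlocks_map, smul_one_eq_diagonal, diagonal_map]

theorem conjMatrix_map {R R' : Type*} [CommRing R] [CommRing R'] (ψ : R →+* R')
    (B : Matrix a b R) (A : Matrix b a R) (c : R) : (conjMatrix B A c).map ψ = conjMatrix (B.map ψ) (A.map ψ) (ψ c) := by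
  rw [conjMatrix_eq, conjMatrix_eq, Matrix.map_mul, Matrix.map_mul, lowerMatrix_map,
    fromBlocks_map, fromBlocks_map]
  simp [Matrix.map_neg]

/-- The tuple of matrices with indices in `Fin n` given by the parameters `B`, `A_i`, `c_i`. -/
def paramPoint {n r : ℕ} {R : Type*} [CommRing R]
    (v : ParamIndex r (Fin (n - n / 2)) (Fin (n / 2)) → R) (i : Fin r) :
    Matrix (Fin n) (Fin n) R :=
  reindex (blockEquiv n) (blockEquiv n) (paramTuple v i)

theorem paramPoint_mem_saturation {k : Type*} [Field k] {n r : ℕ}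
    (v : ParamIndex r (Fin (n - n / 2)) (Fin (n / 2)) → k) : paramPoint v ∈ saturation k n r := by
  refine mem_saturation_iff.2 ⟨_, _, fun i => of fun s t => v (.inr (i, .inl (s, t))),
    fun i => v (.inr (i, .inr ())), unipotent_mul_neg (of fun s t => v (.inl (s, t))),
    fun i => ?_⟩
  rw [← conjMatrix_eq]
  rfl

/-- Along a polynomial path to the conjugating matrix, `f` is a polynomial in `t` that vanishes
wherever the lower right block is invertible. That holds at `t = 0`, so the polynomial is zero, in
particular at `t = 1`. -/
theorem aeval_eq_zero_of_mem_saturation {k : Type*} [Field k] [Infinite k] {n r : ℕ}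
    {f : MvPolynomial (Fin r × Fin n × Fin n) k}
    (hf : ∀ v : ParamIndex r (Fin (n - n / 2)) (Fin (n / 2)) → k,
      MvPolynomial.aeval (coords (paramPoint v)) f = 0)
    {x : Fin r → Matrix (Fin n) (Fin n) k} (hx : x ∈ saturation k n r) :
    MvPolynomial.aeval (coords x) f = 0 := by
  obtain ⟨M, M', A, c, hM, hx⟩ := mem_saturation_iff.1 hx
  have hdet : M.det ≠ 0 := by
    intro h
    have := congrArg det hM
    rw [det_mul, h, zero_mul, det_one] at this
    exact zero_ne_one this
  obtain ⟨G, G', hG, hG1, D, hD, hG0⟩ := exists_polynomial_path M hdet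
  let y : Fin r → Matrix (Fin n) (Fin n) (Polynomial k) := fun i =>
    reindex (blockEquiv n) (blockEquiv n)
      (G * lowerMatrix ((A i).map Polynomial.C) (Polynomial.C (c i)) * G')
  have hmul : ∀ t : k, G.map (Polynomial.eval t) * G'.map (Polynomial.eval t) = 1 := by
    intro t
    have := congrArg (Polynomial.evalRingHom t).mapMatrix hG
    rwa [map_mul, map_one] at this
  have hy : ∀ t : k, (MvPolynomial.aeval (coords y) f).eval t =
      MvPolynomial.aeval (coords fun i => reindex (blockEquiv n) (blockEquiv n)
        (G.map (Polynomial.eval t) * lowerMatrix (A i) (c i) * G'.map (Polynomial.eval t))) f := by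
    intro t
    rw [← Polynomial.coe_aeval_eq_eval, aeval_coords_map]
    congr 3
    funext i
    have h : lowerMatrix (A i) (c i) =
        (lowerMatrix ((A i).map Polynomial.C) (Polynomial.C (c i))).map
          (Polynomial.evalRingHom t) := by
      rw [lowerMatrix_map, map_map]
      simp [Function.comp_def]
    rw [h, Polynomial.coe_aeval_eq_eval, ← Polynomial.coe_evalRingHom, ← Matrix.map_mul,
      ← Matrix.map_mul]
    rfl
  have hzero : MvPolynomial.aeval (coords y) f = 0 := by
    -- The determinant factor absorbs the values of `t` outside the big cell; `k` is infinite, so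
    -- checking values suffices.
    have h0 : G.toBlocks₂₂.det * MvPolynomial.aeval (coords y) f = 0 := by
      refine Polynomial.funext fun t => ?_
      rw [Polynomial.eval_mul, Polynomial.eval_zero, hy]
      by_cases ht : G.toBlocks₂₂.det.eval t = 0
      · rw [ht, zero_mul]
      · have hu : IsUnit (G.map (Polynomial.eval t)).toBlocks₂₂.det := by
          rw [isUnit_iff_ne_zero]
          rw [← Polynomial.coe_evalRingHom, RingHom.map_det] at ht
          exact ht
        obtain ⟨B, E, hBE⟩ := conj_lowerMatrix_of_isUnit (hmul t) hu
        simp only [hBE]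
        have := hf (Sum.elim (fun p => B p.1 p.2) fun q =>
          Sum.elim (fun p => E (A q.1) p.1 p.2) (fun _ => c q.1) q.2)
        rw [mul_eq_zero]
        exact .inr this
    refine (mul_eq_zero.1 h0).resolve_left fun h => ?_
    have h1 := congrArg (Polynomial.evalRingHom (0 : k)) h
    rw [RingHom.map_det, map_zero] at h1
    have h2 : (Polynomial.evalRingHom (0 : k)).mapMatrix G.toBlocks₂₂ =
        diagonal fun i => D (.inr i) := by
      have h3 := congrArg toBlocks₂₂ hG0
      rw [toBlocks₂₂_diagonal] at h3
      exact h3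
    rw [h2, det_diagonal, Finset.prod_eq_zero_iff] at h1
    obtain ⟨i, -, hi⟩ := h1
    exact hD _ hi
  have h1 := hy 1
  rw [hzero, Polynomial.eval_zero, hG1] at h1
  have hM' : G'.map (Polynomial.eval 1) = M' := by
    have h2 := hmul 1
    rw [hG1] at h2
    rw [← Matrix.one_mul (G'.map _), ← mul_eq_one_comm.1 hM, Matrix.mul_assoc, h2, Matrix.mul_one]
  rw [hM'] at h1
  rw [funext hx]
  exact h1.symm

/-- The comorphism of the parametrization of a dense subset of `G · (u_P + k I_n)^r`. -/
noncomputable def paramHom (k : Type*) [Field k] (n r : ℕ) :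
    MvPolynomial (Fin r × Fin n × Fin n) k →ₐ[k]
      MvPolynomial (ParamIndex r (Fin (n - n / 2)) (Fin (n / 2))) k :=
  MvPolynomial.aeval (coords (paramPoint MvPolynomial.X))

theorem aeval_paramHom {k : Type*} [Field k] {n r : ℕ}
    (v : ParamIndex r (Fin (n - n / 2)) (Fin (n / 2)) → k)
    (f : MvPolynomial (Fin r × Fin n × Fin n) k) :
    MvPolynomial.aeval v (paramHom k n r f) = MvPolynomial.aeval (coords (paramPoint v)) f := by
  rw [paramHom, aeval_coords_map]
  congr 3
  funext i
  have := conjMatrix_map (MvPolynomial.aeval (R := k) v).toRingHom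
    (of fun s t => MvPolynomial.X (.inl (s, t)))
    (of fun s t => MvPolynomial.X (.inr (i, .inl (s, t)))) (MvPolynomial.X (.inr (i, .inr ())))
  have h2 : (paramTuple MvPolynomial.X i).map (MvPolynomial.aeval (R := k) v) = paramTuple v i := by
    refine this.trans ?_
    simp only [paramTuple]
    congr 1
    · ext; simp
    · ext; simp
    · simp
  rw [paramPoint, paramPoint, ← h2]
  rfl

theorem vanishingIdeal_saturation (k : Type*) [Field k] [Infinite k] (n r : ℕ) :
    MvPolynomial.vanishingIdeal k (coords '' saturation k n r) = RingHom.ker (paramHom k n r) := by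
  ext f
  rw [MvPolynomial.mem_vanishingIdeal_iff, RingHom.mem_ker, Set.forall_mem_image]
  constructor
  · intro h
    refine MvPolynomial.funext fun v => ?_
    rw [map_zero, ← MvPolynomial.coe_aeval_eq_eval]
    exact (aeval_paramHom v f).trans (h (paramPoint_mem_saturation v))
  · intro h x hx
    refine aeval_eq_zero_of_mem_saturation (fun v => ?_) hx
    rw [← aeval_paramHom, h, map_zero]

theorem varietyDim_mono {k : Type*} [Field k] {n r : ℕ}
    {V W : Set (Fin r → Matrix (Fin n) (Fin n) k)} (h : V ⊆ W) : varietyDim V ≤ varietyDim W :=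
  ringKrullDim_le_of_surjective
    (Ideal.Quotient.factor (MvPolynomial.vanishingIdeal_anti_mono (Set.image_mono h)))
    (Ideal.Quotient.factor_surjective _)

theorem varietyDim_saturation (k : Type*) [Field k] [Infinite k] {n r : ℕ} (hn : 0 < n)
    (hr : 0 < r) :
    varietyDim (saturation k n r) =
      (((r + 1) * Module.finrank k (uP k n) + r : ℕ) : WithBot ℕ∞) := by
  have : Nonempty (Fin (n - n / 2)) := ⟨⟨0, by omega⟩⟩
  rw [varietyDim, vanishingIdeal_saturation,
    ringKrullDim_eq_of_ringEquiv (Ideal.quotientKerEquivRange (paramHom k n r)).toRingEquiv,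
    MvPolynomial.ringKrullDim_range_of_isAlgebraic]
  · congr 1
    rw [finrank_uP, Nat.card_eq_fintype_card]
    simp only [Fintype.card_sum, Fintype.card_prod, Fintype.card_fin, Fintype.card_unit]
    ring
  -- The larger block comes first, so the column indices of `B` embed into its row indices.
  · refine isAlgebraic_X_of_paramTuple_mem (Fin.castLEEmb (by omega)) hr _ fun i s t => ?_
    refine ⟨MvPolynomial.X (i, blockEquiv n s, blockEquiv n t), ?_⟩
    simp [paramHom, coords, paramPoint]

end CommutingVariety

theorem mainTheorem7 {k : Type*} [Field k] [IsAlgClosed k] (n r : ℕ) (hn : 1 ≤ n) (hr : 1 ≤ r) :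
    (((r + 1) * Module.finrank k (CommutingVariety.uP k n) + r : ℕ) : WithBot ℕ∞) ≤
        CommutingVariety.varietyDim (CommutingVariety.commutingVariety k n r) ∧
      CommutingVariety.saturation k n r ⊆ CommutingVariety.commutingVariety k n r ∧
      CommutingVariety.varietyDim (CommutingVariety.saturation k n r) =
        (((r + 1) * Module.finrank k (CommutingVariety.uP k n) + r : ℕ) : WithBot ℕ∞) ∧
      ((4 ≤ n ∧ 9 ≤ r) ∨ (12 ≤ n ∧ 4 ≤ r) →
        n ^ 2 + (r - 1) * n < (r + 1) * Module.finrank k (CommutingVariety.uP k n) + r) := by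
  have : Infinite k := IsAlgClosed.instInfinite
  have hsub := CommutingVariety.saturation_subset_commutingVariety k n r
  have hdim := CommutingVariety.varietyDim_saturation k hn hr
  exact ⟨hdim ▸ CommutingVariety.varietyDim_mono hsub, hsub, hdim,
    CommutingVariety.lt_finrank_mul_add (CommutingVariety.finrank_uP k n)⟩
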